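/- Let $\mathcal H$ be a complex Hilbert space of finite dimension $d$. For a finite sequence $\mathcal F=\{f_i\}_{i=1}^n$ in $\mathcal H$ let $S_{\mathcal F}=\sum_{i=1}^n \langle\,\cdot\,,f_i\rangle f_i$ be its frame operator. Write $\lambda(S)$ for the vector of eigenvalues of a selfadjoint operator $S$, counted with multiplicity and in decreasing order, $\lambda^{\uparrow}(S)$ for the same vector in increasing order, and $x^{\downarrow}$ for the decreasing rearrangement of $x\in\mathbb R^d$. Let $\mathcal F_0=\{f_i\}_{i=1}^{n_0}$ be a sequence in $\mathcal H$ and $\mathbf a=(\alpha_1,\dots,\alpha_k)$ a vector with positive entries such that $d-\operatorname{rk} S_{\mathcal F_0}\le k$; put $n=n_0+k$. Let $$\mathcal C_{\mathbf a}(\mathcal F_0)=\{\mathcal F=(\mathcal F_0,\mathcal G)\in\mathcal H^n:\ \mathcal G=\{g_i\}_{i=1}^k,\ \|g_i\|^2=\alpha_i\ (1\le i\le k)\},$$ $$\mathcal C^{\rm op}_{\mathbf a}(\mathcal F_0)=\{\mathcal F=(\mathcal F_0,\mathcal G)\in\mathcal C_{\mathbf a}(\mathcal F_0):\ \lambda(S_{\mathcal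 F})=(\lambda(S_{\mathcal F_0})+\lambda^{\uparrow}(S_{\mathcal G}))^{\downarrow}\}.$$ Let $f:[0,\infty)\to\mathbb R$ be strictly convex and let $P_f(\mathcal F)=\operatorname{tr} f(S_{\mathcal F})$ be the associated convex potential. Consider the pseudo-metric $d_S(\mathcal F,\mathcal F')=\|S_{\mathcal F}-S_{\mathcal F'}\|$ (operator norm). Then every $d_S$-local minimizer $\mathcal F$ of $P_f$ on $\mathcal C^{\rm op}_{\mathbf a}(\mathcal F_0)$ (that is, $\mathcal F\in\mathcal C^{\rm op}_{\mathbf a}(\mathcal F_0)$ and for some $\varepsilon>0$ one has $P_f(\mathcal F)\le P_f(\mathcal F')$ for all $\mathcal F'\in\mathcal C^{\rm op}_{\mathbf a}(\mathcal F_0)$ with $d_S(\mathcal F,\mathcal F')<\varepsilon$) is a global minimizer of $P_f$ on $\mathcal C^{\rm op}_{\mathbf a}(\mathcal F_0)$, and indeed on $\mathcal C_{\mathbf a}(\mathcal F_0)$. -/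

import Mathlib

namespace FrameCompletion

/-- The increasing rearrangement of a finite real vector. -/
noncomputable def incRearr {m : ℕ} (x : Fin m → ℝ) : Fin m → ℝ :=
  x ∘ Tuple.sort x

/-- The decreasing rearrangement of a finite real vector. -/
noncomputable def decRearr {m : ℕ} (x : Fin m → ℝ) : Fin m → ℝ :=
  incRearr x ∘ Fin.rev

section

variable {H : Type*} [NormedAddCommGroup H] [InnerProductSpace ℂ H] {n : ℕ}

/-- The frame operator `S_F = ∑ i, f_i ⊗ f_i` of a finite sequence `F = (f_i)` in `H`, where
`x ⊗ x` is the operator `z ↦ ⟨z, x⟩ x`. -/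
noncomputable def frameOperator (F : Fin n → H) : H →L[ℂ] H :=
  ∑ i, InnerProductSpace.rankOne ℂ (F i) (F i)

theorem frameOperator_apply (F : Fin n → H) (z : H) :
    frameOperator F z = ∑ i, inner ℂ (F i) z • F i := by
  simp [frameOperator, InnerProductSpace.rankOne_apply]

theorem frameOperator_isSymmetric (F : Fin n → H) :
    (frameOperator F : H →ₗ[ℂ] H).IsSymmetric := by
  intro x y
  simp only [ContinuousLinearMap.coe_coe, frameOperator_apply, sum_inner, inner_sum,
    inner_smul_left, inner_smul_right, inner_conj_symm]
  exact Finset.sum_congr rfl fun i _ => mul_comm _ _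

/-- The pseudo-metric `d_S(F, F') = ‖S_F - S_F'‖` (operator norm). -/
noncomputable def dS (F F' : Fin n → H) : ℝ :=
  ‖frameOperator F - frameOperator F'‖

variable [FiniteDimensional ℂ H]

/-- The vector `λ(S_F)` of eigenvalues of the frame operator of `F`, counted with multiplicity
and arranged in decreasing order. -/
noncomputable def frameSpectrum (F : Fin n → H) : Fin (Module.finrank ℂ H) → ℝ :=
  (frameOperator_isSymmetric F).eigenvalues rfl

theorem frameSpectrum_antitone (F : Fin n → H) : Antitone (frameSpectrum F) :=
  (frameOperator_isSymmetric F).eigenvalues_antitone rfl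

/-- The convex potential `P_f(F) = tr f(S_F)`. Here `f(S_F)` is given by the continuous functional
calculus (the spectrum of `S_F` is a finite subset of `[0, ∞)`, so any `f` is admissible and only
its values on `[0, ∞)` matter); it is selfadjoint, so its trace is real. -/
noncomputable def convexPotential [CompleteSpace H] (f : ℝ → ℝ) (F : Fin n → H) : ℝ :=
  (LinearMap.trace ℂ H (cfc f (frameOperator F) : H →L[ℂ] H)).re

end

section

variable {H : Type*} [NormedAddCommGroup H] [InnerProductSpace ℂ H] {n₀ k : ℕ}

/-- The last `k` vectors `G` of a sequence `F = (F₀, G)`. -/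
def completing (F : Fin (n₀ + k) → H) : Fin k → H :=
  fun i => F (Fin.natAdd n₀ i)

/-- The completions `F = (F₀, G)` of `F₀` with prescribed norms `‖g_i‖² = a_i`. -/
def completions (F₀ : Fin n₀ → H) (a : Fin k → ℝ) : Set (Fin (n₀ + k) → H) :=
  {F | (∀ i, F (Fin.castAdd k i) = F₀ i) ∧ ∀ i, ‖completing F i‖ ^ 2 = a i}

/-- The completions `F = (F₀, G)` whose frame operator has spectrum
`λ(S_F) = (λ(S_{F₀}) + λ↑(S_G))↓`. -/
def opCompletions [FiniteDimensional ℂ H] (F₀ : Fin n₀ → H) (a : Fin k → ℝ) :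
    Set (Fin (n₀ + k) → H) :=
  {F | F ∈ completions F₀ a ∧
    frameSpectrum F = decRearr (frameSpectrum F₀ + incRearr (frameSpectrum (completing F)))}

end

/-- `F` is a local minimizer of `P` on the set `C` with respect to the pseudo-metric `d_S`. -/
def IsDSLocalMinimizer {H : Type*} [NormedAddCommGroup H] [InnerProductSpace ℂ H] {n : ℕ}
    (P : (Fin n → H) → ℝ) (C : Set (Fin n → H)) (F : Fin n → H) : Prop :=
  F ∈ C ∧ ∃ ε > 0, ∀ F' ∈ C, dS F F' < ε → P F ≤ P F'

end FrameCompletion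

/-! Put λ = λ(S_{F₀}) and let y be the decreasing spectrum of S_G. Oppositely ordered spectra give
the least potential: for every completion, P_f(F) ≥ Σ f(λ_i + y↑_i), with equality on the `op`
completions. This is a Lidskii-type majorization (`sum_max_le_of_isDiag_add`) combined with
Karamata's inequality.

By Schur–Horn, the admissible y are exactly the decreasing nonnegative vectors majorizing a. These
conditions form a convex set, so the spectrum of any competitor F' can be joined to that of F by a
segment of admissible spectra.

The segment must be lifted to operators near S_F. This is the role of the equality case
`IsDiag.exists_common_of_sum_sq_eq`: for F in the `op` set, S_{F₀} and S_G have a common eigenbasis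
with opposite orders. Realizing (1 - t)y + ty' in that same basis stays in the `op` set and moves
the frame operator by O(t). Convexity along the segment then excludes any F' with a smaller
potential. -/

namespace FrameCompletion

/-! ### Operators with a real spectrum in an orthonormal basis; Weyl monotonicity; trace and
functional calculus. -/

section Diagonal

variable {H : Type*} [NormedAddCommGroup H] [InnerProductSpace ℂ H] {n : ℕ}

/-- `T` is diagonal in the orthonormal basis `b`, with real eigenvalues `x`. -/
def IsDiag (T : H →L[ℂ] H) (b : OrthonormalBasis (Fin n) ℂ H) (x : Fin n → ℝ) : Prop :=
  ∀ i, T (b i) = (x i : ℂ) • b i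

/-- The operator which is diagonal in `b` with eigenvalues `x`. -/
noncomputable def diagOp (b : OrthonormalBasis (Fin n) ℂ H) (x : Fin n → ℝ) : H →L[ℂ] H :=
  ∑ i, (x i : ℂ) • InnerProductSpace.rankOne ℂ (b i) (b i)

variable {T T' : H →L[ℂ] H} {b b' : OrthonormalBasis (Fin n) ℂ H} {x x' : Fin n → ℝ}

theorem isDiag_diagOp (b : OrthonormalBasis (Fin n) ℂ H) (x : Fin n → ℝ) :
    IsDiag (diagOp b x) b x := by
  intro i
  simp [diagOp, InnerProductSpace.rankOne_apply, OrthonormalBasis.inner_eq_ite]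

theorem IsDiag.add (h : IsDiag T b x) (h' : IsDiag T' b x') : IsDiag (T + T') b (x + x') := by
  intro i
  simp [h i, h' i, add_smul]

theorem IsDiag.sub (h : IsDiag T b x) (h' : IsDiag T' b x') : IsDiag (T - T') b (x - x') := by
  intro i
  simp [h i, h' i, sub_smul]

theorem IsDiag.neg (h : IsDiag T b x) : IsDiag (-T) b (-x) := by
  intro i
  simp [h i]

theorem IsDiag.smul (h : IsDiag T b x) (c : ℝ) : IsDiag ((c : ℂ) • T) b (c • x) := by
  intro i
  rw [smul_apply, h i, smul_smul, Pi.smul_apply, smul_eq_mul,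
    Complex.ofReal_mul]

theorem IsDiag.mul (h : IsDiag T b x) (h' : IsDiag T' b x') : IsDiag (T * T') b (x * x') := by
  intro i
  rw [mul_apply_eq_comp, h' i, map_smul, h i, smul_smul, Pi.mul_apply,
    Complex.ofReal_mul, mul_comm]

theorem isDiag_one (b : OrthonormalBasis (Fin n) ℂ H) : IsDiag (1 : H →L[ℂ] H) b 1 := by
  intro i
  simp

theorem IsDiag.reindex (h : IsDiag T b x) (σ : Equiv.Perm (Fin n)) :
    IsDiag T (b.reindex σ.symm) (x ∘ σ) := by
  intro i
  simp [h (σ i)]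

theorem IsDiag.ext (h : IsDiag T b x) (h' : IsDiag T' b x) : T = T' := by
  refine ContinuousLinearMap.coe_injective (b.toBasis.ext fun i => ?_)
  simp [h i, h' i]

theorem IsDiag.apply (h : IsDiag T b x) (v : H) :
    T v = ∑ i, (x i : ℂ) • inner ℂ (b i) v • b i := by
  conv_lhs => rw [← b.sum_repr' v]
  simp only [map_sum, map_smul, h _]
  exact Finset.sum_congr rfl fun i _ => smul_comm _ _ _

theorem IsDiag.re_inner (h : IsDiag T b x) (v : H) :
    (inner ℂ v (T v)).re = ∑ i, x i * ‖inner ℂ (b i) v‖ ^ 2 := by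
  rw [h.apply, inner_sum, Complex.re_sum]
  refine Finset.sum_congr rfl fun i _ => ?_
  rw [inner_smul_right, inner_smul_right, Complex.re_ofReal_mul, ← inner_conj_symm v (b i),
    Complex.mul_conj, Complex.ofReal_re, Complex.normSq_eq_norm_sq]

theorem IsDiag.isSymmetric (h : IsDiag T b x) : (T : H →ₗ[ℂ] H).IsSymmetric := by
  intro u v
  simp only [ContinuousLinearMap.coe_coe, h.apply, sum_inner, inner_sum, inner_smul_left,
    inner_smul_right, inner_conj_symm, Complex.conj_ofReal]
  exact Finset.sum_congr rfl fun i _ => by ring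

/-- Monotonicity of the ordered eigenvalues (Weyl). -/
theorem IsDiag.le_of_le (h : IsDiag T b x) (h' : IsDiag T' b' x') (hx : Antitone x)
    (hx' : Antitone x') (hle : ∀ v, (inner ℂ v (T v)).re ≤ (inner ℂ v (T' v)).re) : x ≤ x' := by
  intro i
  have : FiniteDimensional ℂ H := b.toBasis.finiteDimensional_of_finite
  -- Courant–Fischer: with indices from 0, the dimensions i + 1 and n - i add up to n + 1, so V and
  -- W share a nonzero vector v. Its quadratic forms satisfy x i ‖v‖² ≤ ⟨v, Tv⟩ ≤ ⟨v, T'v⟩ ≤ x' i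
  -- ‖v‖².
  let V := Submodule.span ℂ (Set.range fun j : {j : Fin n // j ≤ i} => b j)
  let W := Submodule.span ℂ (Set.range fun j : {j : Fin n // i ≤ j} => b' j)
  have hV : Module.finrank ℂ V = i + 1 := by
    rw [← Fin.card_Iic i, ← Fintype.card_of_subtype _ fun j => Finset.mem_Iic]
    exact finrank_span_eq_card (b.orthonormal.linearIndependent.comp _ Subtype.val_injective)
  have hW : Module.finrank ℂ W = n - i := by
    rw [← Fin.card_Ici i, ← Fintype.card_of_subtype _ fun j => Finset.mem_Ici]
    exact finrank_span_eq_card (b'.orthonormal.linearIndependent.comp _ Subtype.val_injective)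
  have hn : Module.finrank ℂ H = n := by simpa using Module.finrank_eq_card_basis b.toBasis
  have hVW : V ⊓ W ≠ ⊥ := by
    intro hd
    have := Submodule.finrank_add_finrank_le_of_disjoint (disjoint_iff.2 hd)
    omega
  obtain ⟨v, hv, hv0⟩ := Submodule.exists_mem_ne_zero_of_ne_bot hVW
  have hvV : ∀ j, ¬ j ≤ i → inner ℂ (b j) v = 0 := fun j hj => by
    have : V ≤ (ℂ ∙ b j)ᗮ := by
      refine Submodule.span_le.2 ?_
      rintro _ ⟨l, rfl⟩
      refine Submodule.mem_orthogonal_singleton_iff_inner_right.2 (b.orthonormal.2 ?_)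
      rintro rfl
      exact hj l.2
    exact Submodule.mem_orthogonal_singleton_iff_inner_right.1 (this hv.1)
  have hvW : ∀ j, ¬ i ≤ j → inner ℂ (b' j) v = 0 := fun j hj => by
    have : W ≤ (ℂ ∙ b' j)ᗮ := by
      refine Submodule.span_le.2 ?_
      rintro _ ⟨l, rfl⟩
      refine Submodule.mem_orthogonal_singleton_iff_inner_right.2 (b'.orthonormal.2 ?_)
      rintro rfl
      exact hj l.2
    exact Submodule.mem_orthogonal_singleton_iff_inner_right.1 (this hv.2)
  have h1 : x i * ‖v‖ ^ 2 ≤ (inner ℂ v (T v)).re := by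
    rw [h.re_inner, ← b.sum_sq_norm_inner_right, Finset.mul_sum]
    refine Finset.sum_le_sum fun j _ => ?_
    by_cases hj : j ≤ i
    · exact mul_le_mul_of_nonneg_right (hx hj) (by positivity)
    · simp [hvV j hj]
  have h2 : (inner ℂ v (T' v)).re ≤ x' i * ‖v‖ ^ 2 := by
    rw [h'.re_inner, ← b'.sum_sq_norm_inner_right, Finset.mul_sum]
    refine Finset.sum_le_sum fun j _ => ?_
    by_cases hj : i ≤ j
    · exact mul_le_mul_of_nonneg_right (hx' hj) (by positivity)
    · simp [hvW j hj]
  have hpos : 0 < ‖v‖ ^ 2 := by positivity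
  exact le_of_mul_le_mul_right (h1.trans ((hle v).trans h2)) hpos

theorem IsDiag.eq_of_antitone (h : IsDiag T b x) (h' : IsDiag T b' x') (hx : Antitone x)
    (hx' : Antitone x') : x = x' :=
  le_antisymm (h.le_of_le h' hx hx' fun _ => le_rfl) (h'.le_of_le h hx' hx fun _ => le_rfl)

/-- The real part of the trace. -/
noncomputable def reTrace : (H →L[ℂ] H) →ₗ[ℝ] ℝ where
  toFun T := (LinearMap.trace ℂ H T).re
  map_add' S T := by simp
  map_smul' c T := by
    have : ((c • T : H →L[ℂ] H) : H →ₗ[ℂ] H) = (c : ℂ) • (T : H →ₗ[ℂ] H) := by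
      ext v; simp
    simp [this]

theorem IsDiag.reTrace_eq (h : IsDiag T b x) : reTrace T = ∑ i, x i := by
  have : FiniteDimensional ℂ H := b.toBasis.finiteDimensional_of_finite
  change (LinearMap.trace ℂ H T).re = _
  rw [LinearMap.trace_eq_sum_inner _ b, Complex.re_sum]
  refine Finset.sum_congr rfl fun i _ => ?_
  rw [ContinuousLinearMap.coe_coe, h i, inner_smul_right, b.inner_eq_one, mul_one,
    Complex.ofReal_re]

theorem reTrace_mul_comm (S T : H →L[ℂ] H) : reTrace (S * T) = reTrace (T * S) := by
  change (LinearMap.trace ℂ H ((S : H →ₗ[ℂ] H) * (T : H →ₗ[ℂ] H))).re = _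
  rw [LinearMap.trace_mul_comm]
  rfl

theorem exists_isDiag [FiniteDimensional ℂ H] (hn : Module.finrank ℂ H = n)
    (hT : (T : H →ₗ[ℂ] H).IsSymmetric) :
    ∃ (b : OrthonormalBasis (Fin n) ℂ H) (x : Fin n → ℝ), IsDiag T b x ∧ Antitone x :=
  ⟨hT.eigenvectorBasis hn, hT.eigenvalues hn, fun i => hT.apply_eigenvectorBasis hn i,
    hT.eigenvalues_antitone hn⟩

/-- The product of the factors X - x_i annihilates T, so the spectrum lies in the range of x. There
f agrees with a Lagrange interpolant, and f(T) is a polynomial in T; no continuity of f is needed.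
-/
theorem IsDiag.cfc_isDiag [CompleteSpace H] (h : IsDiag T b x) (f : ℝ → ℝ) :
    IsDiag (cfc f T) b (f ∘ x) := by
  have hsa : IsSelfAdjoint T := h.isSymmetric.isSelfAdjoint
  have hpoly : ∀ p : Polynomial ℝ, IsDiag (Polynomial.aeval T p) b fun i => p.eval (x i) := by
    intro p
    induction p using Polynomial.induction_on' with
    | add p q hp hq => simpa using! hp.add hq
    | monomial m c =>
      have hm : ∀ m : ℕ, IsDiag (T ^ m) b (x ^ m) := by
        intro m
        induction m with
        | zero => simpa using isDiag_one b
        | succ m ih => simpa only [pow_succ] using ih.mul h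
      have : Polynomial.aeval T (Polynomial.monomial m c) = (c : ℂ) • T ^ m := by
        rw [Polynomial.aeval_monomial, Algebra.algebraMap_eq_smul_one, smul_one_mul]
        ext v; simp
      rw [this]
      convert! (hm m).smul c using 1
      ext i; simp
  have hspec : spectrum ℝ T ⊆ Set.range x := by
    classical
    intro r hr
    let p : Polynomial ℝ := ∏ i, (Polynomial.X - Polynomial.C (x i))
    have hp : Polynomial.aeval T p = 0 := by
      have h0 : IsDiag (0 : H →L[ℂ] H) b fun i => p.eval (x i) := by
        intro i
        have : p.eval (x i) = 0 := by
          simp only [p, Polynomial.eval_prod]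
          exact Finset.prod_eq_zero (Finset.mem_univ i) (by simp)
        simp [this]
      exact (hpoly p).ext h0
    have := spectrum.subset_polynomial_aeval T p ⟨r, hr, rfl⟩
    rw [hp] at this
    have hr0 : p.eval r = 0 := by
      by_contra hne
      refine this ?_
      rw [spectrum.mem_resolventSet_iff, sub_zero]
      exact (isUnit_iff_ne_zero.2 hne).map (algebraMap ℝ (H →L[ℂ] H))
    simp only [p, Polynomial.eval_prod, Finset.prod_eq_zero_iff, Polynomial.eval_sub,
      Polynomial.eval_X, Polynomial.eval_C, sub_eq_zero] at hr0
    obtain ⟨i, -, hi⟩ := hr0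
    exact ⟨i, hi.symm⟩
  classical
  let q := Lagrange.interpolate (Finset.univ.image x) id f
  have hq : ∀ i, q.eval (x i) = f (x i) := fun i =>
    Lagrange.eval_interpolate_at_node f (Set.injOn_id _) (Finset.mem_image_of_mem x (Finset.mem_univ i))
  have hfq : cfc f T = Polynomial.aeval T q := by
    rw [← cfc_polynomial q T hsa]
    refine cfc_congr fun r hr => ?_
    obtain ⟨i, rfl⟩ := hspec hr
    exact (hq i).symm
  rw [hfq]
  intro i
  simpa [hq i] using hpoly q i

end Diagonal

/-! ### Karamata's inequality through hinge functions. -/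

section Karamata

/-- On a finite set, a convex function agrees with an affine function plus a combination of the
functions `t ↦ max (t - p) 0` with nonnegative coefficients. -/
theorem exists_piecewise_linear_interpolation {s : Set ℝ} {f : ℝ → ℝ} (hf : ConvexOn ℝ s f)
    (good : (ℝ → ℝ) → Prop) (haff : ∀ a c : ℝ, good fun t => a + c * t)
    (hadd : ∀ (h : ℝ → ℝ) (p α : ℝ), 0 ≤ α → good h → good fun t => h t + α * max (t - p) 0)
    (u : Finset ℝ) (hu : (u : Set ℝ) ⊆ s) : ∃ h, good h ∧ ∀ t ∈ u, h t = f t := by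
  -- The interpolant is built from left to right. The invariant records the last node p and the
  -- slope β of the final affine piece. Since β is at most every chord slope to a later node, the
  -- next slope change γ - β is nonnegative.
  suffices H : ∀ v : Finset ℝ, v ⊆ u → ∃ h, good h ∧ (∀ t ∈ v, h t = f t) ∧
      (v.Nonempty → ∃ p ∈ v, ∃ β : ℝ, (∀ t ∈ v, t ≤ p) ∧ (∀ t, p ≤ t → h t = f p + β * (t - p)) ∧
        ∀ t ∈ u, p < t → β ≤ (f t - f p) / (t - p)) by
    obtain ⟨h, hg, hh, -⟩ := H u le_rfl
    exact ⟨h, hg, hh⟩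
  intro v
  induction v using Finset.induction_on_max with
  | empty => exact fun _ => ⟨_, haff 0 0, by simp, by simp⟩
  | insert m v hm ih =>
    intro hv
    have hmu : m ∈ u := hv (Finset.mem_insert_self m v)
    have hvu : v ⊆ u := (Finset.subset_insert m v).trans hv
    obtain ⟨h, hg, hh, hp⟩ := ih hvu
    rcases v.eq_empty_or_nonempty with rfl | hne
    · obtain ⟨β, hβ⟩ := (u.image fun t => (f t - f m) / (t - m)).bddBelow
      refine ⟨_, haff (f m - β * m) β, ?_, fun _ => ⟨m, by simp, β, by simp, ?_, ?_⟩⟩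
      · simp
      · intro t _; ring
      · intro t ht _
        exact hβ (by simpa using ⟨t, ht, rfl⟩)
    · obtain ⟨p, hpv, β, hpmax, hlin, hslope⟩ := hp hne
      have hpm : p < m := hm p hpv
      have hpm' : 0 < m - p := sub_pos.2 hpm
      set γ := (f m - f p) / (m - p) with hγ
      have hγm : γ * (m - p) = f m - f p := div_mul_cancel₀ _ hpm'.ne'
      have hnew : ∀ t, p ≤ t → h t + (γ - β) * max (t - p) 0 = f p + γ * (t - p) := by
        intro t ht
        rw [hlin t ht, max_eq_left (sub_nonneg.2 ht)]
        ring
      refine ⟨_, hadd h p (γ - β) (sub_nonneg.2 (hslope m hmu hpm)) hg, ?_,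
        fun _ => ⟨m, Finset.mem_insert_self m v, γ, ?_, ?_, ?_⟩⟩
      · intro t ht
        rcases Finset.mem_insert.1 ht with rfl | ht
        · rw [hnew t hpm.le, hγm]; ring
        · rw [max_eq_right (sub_nonpos.2 (hpmax t ht)), hh t ht]; ring
      · intro t ht
        rcases Finset.mem_insert.1 ht with rfl | ht
        · exact le_rfl
        · exact (hm t ht).le
      · intro t ht
        have : γ * (t - p) = γ * (t - m) + γ * (m - p) := by ring
        rw [hnew t (hpm.le.trans ht), this, hγm]; ring
      · intro t ht hmt
        exact hf.slope_mono_adjacent (hu (hvu hpv)) (hu ht) hpm hmt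

/-- Karamata's inequality, with majorization expressed by the functions `t ↦ max (t - c) 0`. -/
theorem sum_le_sum_of_sum_max_le {ι : Type*} [Fintype ι] {s : Set ℝ} {f : ℝ → ℝ}
    (hf : ConvexOn ℝ s f) {x y : ι → ℝ} (hx : ∀ i, x i ∈ s) (hy : ∀ i, y i ∈ s)
    (hsum : ∑ i, x i = ∑ i, y i)
    (hmax : ∀ c, ∑ i, max (x i - c) 0 ≤ ∑ i, max (y i - c) 0) :
    ∑ i, f (x i) ≤ ∑ i, f (y i) := by
  classical
  obtain ⟨h, hg, hh⟩ := exists_piecewise_linear_interpolation hf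
    (fun h => ∑ i, h (x i) ≤ ∑ i, h (y i))
    (fun a c => by simp [Finset.sum_add_distrib, ← Finset.mul_sum, hsum])
    (fun h p α hα hh => by
      simp only [Finset.sum_add_distrib, ← Finset.mul_sum]
      exact add_le_add hh (mul_le_mul_of_nonneg_left (hmax p) hα))
    (Finset.univ.image x ∪ Finset.univ.image y)
    (by
      intro t ht
      simp only [Finset.coe_union, Finset.coe_image, Finset.coe_univ, Set.image_univ] at ht
      rcases ht with ⟨i, rfl⟩ | ⟨i, rfl⟩
      exacts [hx i, hy i])
  have h1 : ∀ i, h (x i) = f (x i) := fun i => hh _ (by simp)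
  have h2 : ∀ i, h (y i) = f (y i) := fun i => hh _ (by simp)
  simpa only [h1, h2] using hg

end Karamata

/-! ### Majorization for sums of selfadjoint operators. -/

section Lidskii

variable {H : Type*} [NormedAddCommGroup H] [InnerProductSpace ℂ H] {n : ℕ}
  {A B : H →L[ℂ] H} {u v w : OrthonormalBasis (Fin n) ℂ H} {x y z : Fin n → ℝ}

/-- Let R be the positive part of A + B - c. Then R - B ≥ -B and R - B + c ≥ A, so by Weyl the
decreasing eigenvalues e of R - B satisfy e_i + y_i ≥ max(x_i + y_i - c, 0). Summing over i gives tr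
R on the left. -/
theorem sum_max_le_of_isDiag_add (hA : IsDiag A u x) (hB : IsDiag B v y) (hC : IsDiag (A + B) w z)
    (hx : Antitone x) (hy : Monotone y) (c : ℝ) :
    ∑ i, max (x i + y i - c) 0 ≤ ∑ i, max (z i - c) 0 := by
  have : FiniteDimensional ℂ H := u.toBasis.finiteDimensional_of_finite
  have hn : Module.finrank ℂ H = n := by simpa using Module.finrank_eq_card_basis u.toBasis
  let r : Fin n → ℝ := fun i => max (z i - c) 0
  have hR := isDiag_diagOp w r
  obtain ⟨b, e, hE, he⟩ := exists_isDiag (T := diagOp w r - B) hn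
    (by
      rw [ContinuousLinearMap.toLinearMap_sub]
      exact hR.isSymmetric.sub hB.isSymmetric)
  have h1 : -y ≤ e := by
    refine hB.neg.le_of_le hE hy.neg he fun q => ?_
    have : 0 ≤ (inner ℂ q (diagOp w r q)).re := by
      rw [hR.re_inner]
      exact Finset.sum_nonneg fun i _ => mul_nonneg (le_max_right _ _) (by positivity)
    simp only [neg_apply, sub_apply, inner_neg_right,
      inner_sub_right, Complex.neg_re, Complex.sub_re]
    linarith
  have h2 : x ≤ e + c • (1 : Fin n → ℝ) := by
    refine hA.le_of_le (hE.add ((isDiag_one b).smul c)) hx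
      (fun i j hij => by simpa using he hij) fun q => ?_
    have hq : (inner ℂ q ((A + B) q)).re ≤
        (inner ℂ q ((diagOp w r + (c : ℂ) • (1 : H →L[ℂ] H)) q)).re := by
      rw [hC.re_inner, (hR.add ((isDiag_one w).smul c)).re_inner]
      refine Finset.sum_le_sum fun i _ => mul_le_mul_of_nonneg_right ?_ (by positivity)
      have := le_max_left (z i - c) 0
      simp only [Pi.add_apply, Pi.smul_apply, Pi.one_apply, smul_eq_mul, mul_one, r]
      linarith
    simp only [add_apply, sub_apply, inner_add_right,
      inner_sub_right, Complex.add_re, Complex.sub_re] at hq ⊢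
    linarith
  have h3 : ∑ i, r i = ∑ i, (e i + y i) := by
    have := hE.reTrace_eq
    rw [map_sub, hR.reTrace_eq, hB.reTrace_eq] at this
    rw [Finset.sum_add_distrib]
    linarith
  change _ ≤ ∑ i, r i
  rw [h3]
  refine Finset.sum_le_sum fun i _ => max_le ?_ ?_
  · have := h2 i
    simp only [Pi.add_apply, Pi.smul_apply, Pi.one_apply, smul_eq_mul, mul_one] at this
    linarith
  · have := h1 i
    simp only [Pi.neg_apply] at this
    linarith

/-- A consequence of Lidskii's inequality: oppositely ordered spectra minimize convex trace
functionals of a sum. -/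
theorem sum_le_sum_of_isDiag_add (hA : IsDiag A u x) (hB : IsDiag B v y) (hC : IsDiag (A + B) w z)
    (hx : Antitone x) (hy : Monotone y) {s : Set ℝ} {f : ℝ → ℝ} (hf : ConvexOn ℝ s f)
    (hs : ∀ i, x i + y i ∈ s) (hz : ∀ i, z i ∈ s) :
    ∑ i, f (x i + y i) ≤ ∑ i, f (z i) := by
  refine sum_le_sum_of_sum_max_le hf hs hz ?_ (sum_max_le_of_isDiag_add hA hB hC hx hy)
  rw [← hC.reTrace_eq, map_add, hA.reTrace_eq, hB.reTrace_eq, Finset.sum_add_distrib]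

end Lidskii

/-! ### The equality case: commutation and a common, oppositely ordered eigenbasis. -/

section Commute

variable {H : Type*} [NormedAddCommGroup H] [InnerProductSpace ℂ H] {n : ℕ}
  {A B : H →L[ℂ] H} {u v w : OrthonormalBasis (Fin n) ℂ H} {x y z : Fin n → ℝ}

theorem IsDiag.unitary_conj [CompleteSpace H] (h : IsDiag B v y) (U : unitary (H →L[ℂ] H)) :
    IsDiag ((U : H →L[ℂ] H) * B * star (U : H →L[ℂ] H))
      (v.map (Unitary.linearIsometryEquiv U)) y := by
  intro i
  have h1 : star (U : H →L[ℂ] H) ((U : H →L[ℂ] H) (v i)) = v i := by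
    rw [← mul_apply_eq_comp, Unitary.coe_star_mul_self, one_apply_eq_self]
  change ((U : H →L[ℂ] H) * B * star (U : H →L[ℂ] H)) ((U : H →L[ℂ] H) (v i)) =
    (y i : ℂ) • (U : H →L[ℂ] H) (v i)
  rw [mul_apply_eq_comp, h1, mul_apply_eq_comp, h i, map_smul]

theorem reTrace_star_mul_self [FiniteDimensional ℂ H] [CompleteSpace H] (X : H →L[ℂ] H) :
    reTrace (star X * X) = ∑ i, ‖X (stdOrthonormalBasis ℂ H i)‖ ^ 2 := by
  change (LinearMap.trace ℂ H _).re = _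
  rw [LinearMap.trace_eq_sum_inner _ (stdOrthonormalBasis ℂ H), Complex.re_sum]
  refine Finset.sum_congr rfl fun i _ => ?_
  rw [ContinuousLinearMap.coe_coe, mul_apply_eq_comp, ContinuousLinearMap.star_eq_adjoint,
    ContinuousLinearMap.adjoint_inner_right]
  exact inner_self_eq_norm_sq (𝕜 := ℂ) _

theorem eq_zero_of_reTrace_star_mul_self [FiniteDimensional ℂ H] [CompleteSpace H]
    {X : H →L[ℂ] H} (hX : reTrace (star X * X) = 0) : X = 0 := by
  rw [reTrace_star_mul_self, Finset.sum_eq_zero_iff_of_nonneg fun i _ => by positivity] at hX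
  refine ContinuousLinearMap.coe_injective ((stdOrthonormalBasis ℂ H).toBasis.ext fun i => ?_)
  simpa using hX i (Finset.mem_univ i)

theorem reTrace_sq_add (A B : H →L[ℂ] H) :
    reTrace ((A + B) * (A + B)) =
      reTrace (A * A) + reTrace (B * B) + 2 * reTrace (A * B) := by
  simp only [add_mul, mul_add, map_add, reTrace_mul_comm B A]
  ring

/-- Two selfadjoint operators for which the trace of the product is minimal on the unitary orbit
commute. -/
theorem commute_of_forall_reTrace_le [FiniteDimensional ℂ H] [CompleteSpace H]
    (hA : IsSelfAdjoint A) (hB : IsSelfAdjoint B)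
    (hmin : ∀ U : unitary (H →L[ℂ] H),
      reTrace (A * B) ≤ reTrace (A * ((U : H →L[ℂ] H) * B * star (U : H →L[ℂ] H)))) :
    Commute A B := by
  -- The commutator X is skew-adjoint, so exp(tX) B exp(-tX) stays in the unitary orbit of B. At t =
  -- 0 the derivative of the trace against A is tr(A(XB - BX)) = tr(X*X), which vanishes by
  -- minimality.
  let X : H →L[ℂ] H := A * B - B * A
  have hstar : star X = -X := by
    simp only [X, star_sub, star_mul, hA.star_eq, hB.star_eq, neg_sub]
  let φ : ℝ → H →L[ℂ] H := fun t => NormedSpace.exp (t • X) * B * NormedSpace.exp (t • -X)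
  have hφ : HasDerivAt φ (X * B + B * -X) 0 := by
    have h1 := hasDerivAt_exp_smul_const (𝕂 := ℝ) X 0
    have h2 := hasDerivAt_exp_smul_const (𝕂 := ℝ) (-X) 0
    have h3 := (h1.mul_const B).mul h2
    simp only [zero_smul, NormedSpace.exp_zero, one_mul, mul_one] at h3
    exact h3
  have hcont : Continuous (reTrace : (H →L[ℂ] H) →ₗ[ℝ] ℝ) :=
    LinearMap.continuous_of_finiteDimensional _
  let τ : (H →L[ℂ] H) →L[ℝ] ℝ := ⟨reTrace, hcont⟩
  have hτ : HasDerivAt (fun t => τ (A * φ t)) (τ (A * (X * B + B * -X))) 0 :=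
    τ.hasFDerivAt.comp_hasDerivAt 0 (hφ.const_mul A)
  have hloc : IsLocalMin (fun t => τ (A * φ t)) 0 := by
    refine Filter.Eventually.of_forall fun t => ?_
    have hmem : t • X ∈ skewAdjoint (H →L[ℂ] H) := by
      rw [skewAdjoint.mem_iff, star_smul, hstar, star_trivial, smul_neg]
    let +nondep : NormedAlgebra ℚ (H →L[ℂ] H) := .restrictScalars ℚ ℂ _
    have hU := NormedSpace.exp_mem_unitary_of_mem_skewAdjoint hmem
    have := hmin ⟨_, hU⟩
    rw [NormedSpace.star_exp, star_smul, hstar, star_trivial] at this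
    simpa [φ, τ] using this
  have h0 := hloc.hasDerivAt_eq_zero hτ
  change reTrace (A * (X * B + B * -X)) = 0 at h0
  have h1 : A * (X * B + B * -X) = A * X * B - A * B * X := by noncomm_ring
  have h2 : star X * X = B * A * X - A * B * X := by rw [hstar]; simp only [X]; noncomm_ring
  have hX : X = 0 := by
    refine eq_zero_of_reTrace_star_mul_self ?_
    rw [h2, map_sub, mul_assoc, reTrace_mul_comm B, ← map_sub, ← h1, h0]
  exact sub_eq_zero.1 hX

/-- The Lidskii bound for t² holds for A + UBU* with the same right side. As tr A² and tr B² are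
constant on the orbit, equality for B says that tr(AB) is minimal over the orbit. -/
theorem IsDiag.commute_of_sum_sq_eq [CompleteSpace H] (hA : IsDiag A u x) (hB : IsDiag B v y)
    (hC : IsDiag (A + B) w z) (hx : Antitone x) (hy : Monotone y)
    (heq : ∑ i, z i ^ 2 = ∑ i, (x i + y i) ^ 2) : Commute A B := by
  have : FiniteDimensional ℂ H := u.toBasis.finiteDimensional_of_finite
  have hn : Module.finrank ℂ H = n := by simpa using Module.finrank_eq_card_basis u.toBasis
  refine commute_of_forall_reTrace_le hA.isSymmetric.isSelfAdjoint hB.isSymmetric.isSelfAdjoint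
    fun U => ?_
  have hB' := hB.unitary_conj U
  set B' := (U : H →L[ℂ] H) * B * star (U : H →L[ℂ] H)
  obtain ⟨b, z', hC', -⟩ := exists_isDiag (T := A + B') hn
    (by
      rw [ContinuousLinearMap.toLinearMap_add]
      exact hA.isSymmetric.add hB'.isSymmetric)
  have h1 := sum_le_sum_of_isDiag_add hA hB' hC' hx hy even_two.convexOn_pow
    (fun _ => Set.mem_univ _) (fun _ => Set.mem_univ _)
  have h2 := (hC.mul hC).reTrace_eq
  have h3 := (hC'.mul hC').reTrace_eq
  rw [reTrace_sq_add, (hA.mul hA).reTrace_eq, (hB.mul hB).reTrace_eq] at h2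
  rw [reTrace_sq_add, (hA.mul hA).reTrace_eq, (hB'.mul hB').reTrace_eq] at h3
  simp only [Pi.mul_apply, ← sq] at h2 h3
  linarith

theorem IsSymmetric.exists_joint_isDiag [FiniteDimensional ℂ H] (hn : Module.finrank ℂ H = n)
    (hA : (A : H →ₗ[ℂ] H).IsSymmetric) (hB : (B : H →ₗ[ℂ] H).IsSymmetric) (hAB : Commute A B) :
    ∃ (w : OrthonormalBasis (Fin n) ℂ H) (x y : Fin n → ℝ), IsDiag A w x ∧ IsDiag B w y := by
  classical
  have hAB' : Commute (A : H →ₗ[ℂ] H) (B : H →ₗ[ℂ] H) :=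
    congrArg (fun T : H →L[ℂ] H => (T : H →ₗ[ℂ] H)) hAB
  have hint := hA.directSum_isInternal_of_commute hB hAB'
  have horth := hA.orthogonalFamily_eigenspace_inf_eigenspace hB
  -- Only finitely many joint eigenspaces are nonzero; the orthogonal decomposition is restricted to
  -- these to extract a basis.
  have : Fintype {i : ℂ × ℂ // Module.End.eigenspace (A : H →ₗ[ℂ] H) i.2 ⊓
      Module.End.eigenspace (B : H →ₗ[ℂ] H) i.1 ≠ ⊥} :=
    (WellFoundedGT.finite_ne_bot_of_iSupIndep hint.submodule_iSupIndep).fintype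
  replace hint := DirectSum.isInternal_ne_bot_iff.2 hint
  replace horth := horth.comp (γ := {i : ℂ × ℂ // Module.End.eigenspace (A : H →ₗ[ℂ] H) i.2 ⊓
      Module.End.eigenspace (B : H →ₗ[ℂ] H) i.1 ≠ ⊥}) Subtype.val_injective
  let w := hint.subordinateOrthonormalBasis hn horth
  have hw := fun i => hint.subordinateOrthonormalBasis_subordinate hn i horth
  have key : ∀ {T : H →L[ℂ] H} (_ : (T : H →ₗ[ℂ] H).IsSymmetric) {c : ℂ} {i : Fin n},
      w i ∈ Module.End.eigenspace (T : H →ₗ[ℂ] H) c → T (w i) = ((c.re : ℝ) : ℂ) • w i := by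
    intro T hT c i hi
    have hne : w i ≠ 0 := w.orthonormal.ne_zero i
    have hc := hT.conj_eigenvalue_eq_self
      (Module.End.hasEigenvalue_of_hasEigenvector ⟨hi, hne⟩)
    rw [Complex.conj_eq_iff_re.1 hc]
    exact Module.End.mem_eigenspace_iff.1 hi
  exact ⟨w, _, _, fun i => key hA (hw i).1, fun i => key hB (hw i).2⟩

/-- If the trace of `A * B` is the minimum allowed by the spectra of `A` and `B`, and `A` and `B`
commute, then they have a common eigenbasis with oppositely ordered eigenvalues. -/
theorem IsDiag.exists_common_of_commute (hA : IsDiag A u x) (hB : IsDiag B v y)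
    (hx : Antitone x) (hy : Monotone y) (hAB : Commute A B)
    (htr : reTrace (A * B) = ∑ i, x i * y i) :
    ∃ w : OrthonormalBasis (Fin n) ℂ H, IsDiag A w x ∧ IsDiag B w y := by
  have : FiniteDimensional ℂ H := u.toBasis.finiteDimensional_of_finite
  have hn : Module.finrank ℂ H = n := by simpa using Module.finrank_eq_card_basis u.toBasis
  obtain ⟨w, p, q, hAp, hBq⟩ := IsSymmetric.exists_joint_isDiag hn hA.isSymmetric hB.isSymmetric hAB
  have hpu : ∀ σ : Equiv.Perm (Fin n), Antitone (p ∘ σ) → p ∘ σ = x := fun σ hσ =>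
    (hAp.reindex σ).eq_of_antitone hA hσ hx
  have hqu : ∀ σ : Equiv.Perm (Fin n), Monotone (q ∘ σ) → q ∘ σ = y := fun σ hσ => by
    have := (hBq.reindex σ).neg.eq_of_antitone hB.neg hσ.neg hy.neg
    exact neg_injective this
  let σ : Equiv.Perm (Fin n) := Tuple.sort (-p)
  have hσ : p ∘ σ = x := hpu σ (by
    have := (Tuple.monotone_sort (-p)).neg
    intro i j hij
    simpa using! this hij)
  let τ : Equiv.Perm (Fin n) := Tuple.sort q
  have hτ : q ∘ τ = y := hqu τ (Tuple.monotone_sort q)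
  let π : Equiv.Perm (Fin n) := σ.trans τ.symm
  have hπ : y ∘ π = q ∘ σ := by
    rw [← hτ]; ext i; simp [π]
  -- The trace hypothesis is equality in the rearrangement inequality, which forces the joint
  -- eigenvalues to be oppositely ordered.
  have hvary : Antivary x (y ∘ π) := by
    have hxy : Antivary x y := hx.antivary hy
    refine hxy.sum_mul_eq_sum_mul_comp_perm_iff.1 ?_
    rw [← htr, (hAp.mul hBq).reTrace_eq, ← Equiv.sum_comp σ (p * q)]
    refine Finset.sum_congr rfl fun i _ => ?_
    rw [← hσ, Pi.mul_apply, Function.comp_apply]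
    exact congrArg _ (congrFun hπ i)
  have hpq : Antivary p q := by
    intro i j hij
    have := @hvary (σ.symm i) (σ.symm j) (by rw [hπ]; simpa using hij)
    rw [← hσ] at this
    simpa using this
  -- As p and q vary oppositely, sorting by q - p sorts both at once, even when one of them has
  -- ties.
  let ρ : Equiv.Perm (Fin n) := Tuple.sort (q - p)
  have hρ : ∀ {i j}, i ≤ j → q (ρ i) - p (ρ i) ≤ q (ρ j) - p (ρ j) := fun hij =>
    Tuple.monotone_sort (q - p) hij
  have hpρ : p ∘ ρ = x := hpu ρ fun i j hij => by
    by_contra! hlt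
    have hlt' : p (ρ i) < p (ρ j) := hlt
    have h1 : q (ρ j) ≤ q (ρ i) := hpq.symm hlt'
    linarith [hρ hij]
  have hqρ : q ∘ ρ = y := hqu ρ fun i j hij => by
    by_contra! hlt
    have hlt' : q (ρ j) < q (ρ i) := hlt
    have h1 : p (ρ i) ≤ p (ρ j) := hpq hlt'
    linarith [hρ hij]
  exact ⟨_, hpρ ▸ hAp.reindex ρ, hqρ ▸ hBq.reindex ρ⟩

/-- If the spectrum of `A + B` is obtained by adding the oppositely ordered spectra of `A` and
`B`, then `A` and `B` have a common eigenbasis with oppositely ordered eigenvalues. -/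
theorem IsDiag.exists_common_of_sum_sq_eq [CompleteSpace H] (hA : IsDiag A u x)
    (hB : IsDiag B v y) (hC : IsDiag (A + B) w z) (hx : Antitone x) (hy : Monotone y)
    (heq : ∑ i, z i ^ 2 = ∑ i, (x i + y i) ^ 2) :
    ∃ b : OrthonormalBasis (Fin n) ℂ H, IsDiag A b x ∧ IsDiag B b y := by
  refine hA.exists_common_of_commute hB hx hy (hA.commute_of_sum_sq_eq hB hC hx hy heq) ?_
  have h := (hC.mul hC).reTrace_eq
  rw [reTrace_sq_add, (hA.mul hA).reTrace_eq, (hB.mul hB).reTrace_eq] at h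
  simp only [Pi.mul_apply, ← sq, heq, add_sq, Finset.sum_add_distrib] at h
  simp only [mul_assoc, ← Finset.mul_sum] at h
  linarith

end Commute

/-! ### Majorization by successive transfers. -/

section Transfer

/-- Induction principle for majorization: if the partial sums of `y` dominate those of the
antitone vector `a`, with the same total, then `a` is obtained from `y` by finitely many transfers
of mass from a coordinate `j` to a later coordinate `p`. -/
theorem transfer_induction {k : ℕ} {R : (Fin k → ℝ) → Prop}
    (hR : ∀ (y : Fin k → ℝ) (j p : Fin k) (δ : ℝ), j ≠ p → 0 ≤ δ → y p + δ ≤ y j → R y →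
      R (y - Pi.single j δ + Pi.single p δ))
    {a : Fin k → ℝ} (ha : Antitone a) (y : Fin k → ℝ)
    (hle : ∀ m, ∑ i ∈ Finset.Iic m, a i ≤ ∑ i ∈ Finset.Iic m, y i)
    (hsum : ∑ i, a i = ∑ i, y i) (hy : R y) : R a := by
  classical
  induction hN : (Finset.univ.filter fun i => a i ≠ y i).card using Nat.strong_induction_on
    generalizing y with
  | _ N ih =>
  by_cases hne : a = y
  · exact hne ▸ hy
  have hlow : (Finset.univ.filter fun i => y i < a i).Nonempty := by
    by_contra hemp
    have hall : ∀ i, a i ≤ y i := fun i => by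
      by_contra! hi
      exact hemp ⟨i, by simpa using hi⟩
    exact hne (funext fun i =>
      (Finset.sum_eq_sum_iff_of_le fun i _ => hall i).1 hsum i (Finset.mem_univ i))
  -- Here p is the first deficient coordinate. Some earlier j has a surplus, since otherwise the
  -- partial sum up to p would be too small. The largest δ overshooting neither target makes one
  -- coordinate exact, so the number of disagreements drops.
  obtain ⟨p, hyp, hpmin⟩ : ∃ p, y p < a p ∧ ∀ i < p, a i ≤ y i := by
    refine ⟨_, by simpa using Finset.min'_mem _ hlow, fun i hi => ?_⟩
    by_contra! h
    exact absurd (Finset.min'_le _ i (by simpa using h)) (not_le.2 hi)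
  obtain ⟨j, hjp, hyj⟩ : ∃ j < p, a j < y j := by
    by_contra! hall
    refine absurd (hle p) (not_le.2 (Finset.sum_lt_sum (fun i hi => ?_) ⟨p, by simp, hyp⟩))
    rcases (Finset.mem_Iic.1 hi).eq_or_lt with rfl | hi
    exacts [hyp.le, hall i hi]
  obtain ⟨δ, hδ, hδj, hδp, hδ'⟩ : ∃ δ, 0 < δ ∧ δ ≤ y j - a j ∧ δ ≤ a p - y p ∧
      (δ = y j - a j ∨ δ = a p - y p) :=
    ⟨min (y j - a j) (a p - y p), lt_min (by linarith) (by linarith), min_le_left _ _,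
      min_le_right _ _, min_choice _ _⟩
  have haj : a p ≤ a j := ha hjp.le
  set y' := y - Pi.single j δ + Pi.single p δ with hy'
  have hy'j : y' j = y j - δ := by simp [hy', hjp.ne]
  have hy'p : y' p = y p + δ := by simp [hy', hjp.ne']
  have hy'i : ∀ i, i ≠ j → i ≠ p → y' i = y i := fun i h1 h2 => by simp [hy', h1, h2]
  have hsum' : ∀ s : Finset (Fin k), ∑ i ∈ s, y' i =
      ∑ i ∈ s, y i - (if j ∈ s then δ else 0) + (if p ∈ s then δ else 0) := fun s => by
    simp [hy', Finset.sum_add_distrib, Finset.sum_sub_distrib]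
  refine ih _ ?_ y' (fun m => ?_) ?_ (hR y j p δ hjp.ne hδ.le (by linarith) hy) rfl
  · rw [← hN]
    refine Finset.card_lt_card ((Finset.ssubset_iff_of_subset fun i hi => ?_).2 ?_)
    · rw [Finset.mem_filter_univ] at hi ⊢
      by_cases h1 : i = j
      · subst h1; exact hyj.ne
      by_cases h2 : i = p
      · subst h2; exact hyp.ne'
      rwa [hy'i i h1 h2] at hi
    · rcases hδ' with h | h
      · exact ⟨j, by simpa using hyj.ne, by simp [hy'j, h]⟩
      · exact ⟨p, by simpa using hyp.ne', by simp [hy'p, h]⟩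
  · rw [hsum']
    simp only [Finset.mem_Iic]
    have hm := hle m
    by_cases hpm : p ≤ m
    · simp [hpm, hjp.le.trans hpm, hm]
    by_cases hjm : j ≤ m
    -- For j ≤ m < p only the loss of δ is seen. All surpluses up to m are nonnegative and the one
    -- at j is at least δ.
    · have hpos : ∀ i ∈ Finset.Iic m, 0 ≤ y i - a i := fun i hi =>
        sub_nonneg.2 (hpmin i ((Finset.mem_Iic.1 hi).trans_lt (not_le.1 hpm)))
      have := Finset.single_le_sum hpos (Finset.mem_Iic.2 hjm)
      rw [Finset.sum_sub_distrib] at this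
      simp only [hpm, hjm, if_true, if_false]
      linarith
    · simpa [hpm, hjm] using hm
  · rw [hsum', hsum]; simp

end Transfer

/-! ### Schur–Horn theorem for frames with prescribed norms. -/

section SchurHorn

variable {H : Type*} [NormedAddCommGroup H] [InnerProductSpace ℂ H] {d k : ℕ}

theorem exists_rotation (g h : H) {r : ℝ} (h1 : ‖h‖ ^ 2 ≤ r) (h2 : r ≤ ‖g‖ ^ 2) :
    ∃ c s : ℝ, c ^ 2 + s ^ 2 = 1 ∧ ‖(c : ℂ) • g + (s : ℂ) • h‖ ^ 2 = r := by
  have hcont : Continuous fun θ : ℝ =>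
      ‖((Real.cos θ : ℝ) : ℂ) • g + ((Real.sin θ : ℝ) : ℂ) • h‖ ^ 2 := by fun_prop
  have := intermediate_value_Icc' (Real.pi_div_two_pos.le) hcont.continuousOn
  obtain ⟨θ, -, hθ⟩ := this (show r ∈ _ by simpa using ⟨h1, h2⟩)
  exact ⟨_, _, Real.cos_sq_add_sin_sq θ, hθ⟩

/-- A rotation of two frame vectors is a unitary change of the sequence and cancels in the sum of
rank-one terms. -/
theorem frameOperator_eq_of_eq_off_pair {G G' : Fin k → H} {j p : Fin k} (hjp : j ≠ p)
    (hoff : ∀ i, i ≠ j → i ≠ p → G' i = G i) {c s : ℝ} (hcs : c ^ 2 + s ^ 2 = 1)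
    (hj : G' j = (c : ℂ) • G j + (s : ℂ) • G p) (hp : G' p = (-s : ℂ) • G j + (c : ℂ) • G p) :
    frameOperator G' = frameOperator G := by
  have hcs' : (c : ℂ) ^ 2 + (s : ℂ) ^ 2 = 1 := by exact_mod_cast hcs
  rw [← sub_eq_zero, frameOperator, frameOperator, ← Finset.sum_sub_distrib,
    Finset.sum_eq_add j p hjp]
  · ext z
    simp only [add_apply, sub_apply, InnerProductSpace.rankOne_apply, hj, hp, inner_add_left,
      inner_smul_left, zero_apply, map_neg, Complex.conj_ofReal]
    match_scalars
    · linear_combination (inner ℂ (G j) z) * hcs'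
    · linear_combination (inner ℂ (G p) z) * hcs'
  · rintro i - ⟨h1, h2⟩
    rw [hoff i h1 h2, sub_self]
  · simp
  · simp

theorem reTrace_rankOne_self [FiniteDimensional ℂ H] (g : H) :
    reTrace (InnerProductSpace.rankOne ℂ g g) = ‖g‖ ^ 2 := by
  change (LinearMap.trace ℂ H _).re = _
  rw [InnerProductSpace.trace_rankOne]
  exact inner_self_eq_norm_sq (𝕜 := ℂ) _

theorem reTrace_frameOperator [FiniteDimensional ℂ H] (G : Fin k → H) :
    reTrace (frameOperator G) = ∑ i, ‖G i‖ ^ 2 := by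
  simp only [frameOperator, map_sum, reTrace_rankOne_self]

/-- Rotating the pair j, p gives the j-th vector its new norm by the intermediate value theorem; the
norm at p is then forced by the unchanged trace. -/
theorem exists_frame_transfer [FiniteDimensional ℂ H] {S : H →L[ℂ] H} (y : Fin k → ℝ)
    (j p : Fin k) (δ : ℝ) (hjp : j ≠ p) (hδ : 0 ≤ δ) (hy : y p + δ ≤ y j)
    (hG : ∃ G : Fin k → H, frameOperator G = S ∧ ∀ i, ‖G i‖ ^ 2 = y i) :
    ∃ G : Fin k → H, frameOperator G = S ∧
      ∀ i, ‖G i‖ ^ 2 = (y - Pi.single j δ + Pi.single p δ : Fin k → ℝ) i := by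
  obtain ⟨G, hGS, hG⟩ := hG
  obtain ⟨c, s, hcs, hr⟩ := exists_rotation (G j) (G p) (r := y j - δ)
    (by rw [hG]; linarith) (by rw [hG]; linarith)
  let G' : Fin k → H := Function.update (Function.update G j ((c : ℂ) • G j + (s : ℂ) • G p)) p
    ((-s : ℂ) • G j + (c : ℂ) • G p)
  have hj : G' j = (c : ℂ) • G j + (s : ℂ) • G p := by simp [G', hjp]
  have hp : G' p = (-s : ℂ) • G j + (c : ℂ) • G p := by simp [G']
  have hoff : ∀ i, i ≠ j → i ≠ p → G' i = G i := fun i h1 h2 => by simp [G', h1, h2]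
  have hS := frameOperator_eq_of_eq_off_pair hjp hoff hcs hj hp
  refine ⟨G', hS.trans hGS, ?_⟩
  have hj' : ‖G' j‖ ^ 2 = y j - δ := by rw [hj, hr]
  have htr := congrArg reTrace hS
  rw [reTrace_frameOperator, reTrace_frameOperator, ← sub_eq_zero, ← Finset.sum_sub_distrib,
    Finset.sum_eq_add j p hjp (by rintro i - ⟨h1, h2⟩; rw [hoff i h1 h2, sub_self]) (by simp)
      (by simp), hj', hG, hG] at htr
  intro i
  by_cases h1 : i = j
  · subst h1; simp [hj', hjp]
  by_cases h2 : i = p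
  · subst h2
    simp only [Pi.add_apply, Pi.sub_apply, Pi.single_eq_same, Pi.single_eq_of_ne h1]
    linarith
  · simp [hoff i h1 h2, hG, h1, h2]

/-- The extension by zero of a finite vector to a sequence. -/
noncomputable def zeroExtend (x : Fin d → ℝ) (i : ℕ) : ℝ := if h : i < d then x ⟨i, h⟩ else 0

@[simp] theorem zeroExtend_val (x : Fin d → ℝ) (i : Fin d) : zeroExtend x i = x i := by
  simp [zeroExtend]

theorem zeroExtend_of_le (x : Fin d → ℝ) {i : ℕ} (h : d ≤ i) : zeroExtend x i = 0 := by
  simp [zeroExtend, h]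

theorem sum_range_zeroExtend (x : Fin d → ℝ) : ∑ i ∈ Finset.range d, zeroExtend x i = ∑ i, x i := by
  rw [← Fin.sum_univ_eq_sum_range]
  simp

theorem zeroExtend_mono {x y : Fin d → ℝ} (h : x ≤ y) (i : ℕ) : zeroExtend x i ≤ zeroExtend y i := by
  unfold zeroExtend
  split_ifs
  exacts [h _, le_rfl]

theorem zeroExtend_combo (x y : Fin d → ℝ) (s t : ℝ) (i : ℕ) :
    zeroExtend (s • x + t • y) i = s * zeroExtend x i + t * zeroExtend y i := by
  unfold zeroExtend
  split_ifs <;> simp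

/-- The vector `a` is majorized by `x`, both extended by zero, if `x` is antitone and
nonnegative. -/
def Majorized (a : Fin k → ℝ) (x : Fin d → ℝ) : Prop :=
  (∀ J : Finset (Fin k), ∑ i ∈ J, a i ≤ ∑ i ∈ Finset.range J.card, zeroExtend x i) ∧
    ∑ i, a i = ∑ i, x i

/-- For fixed a every condition is affine in x, because the coordinates of x are summed in their
given order and not sorted. -/
theorem Majorized.combo {a : Fin k → ℝ} {x y : Fin d → ℝ} (hx : Majorized a x)
    (hy : Majorized a y) {s t : ℝ} (hs : 0 ≤ s) (ht : 0 ≤ t) (hst : s + t = 1) :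
    Majorized a (s • x + t • y) := by
  constructor
  · intro J
    simp only [zeroExtend_combo, Finset.sum_add_distrib, ← Finset.mul_sum]
    have h1 := mul_le_mul_of_nonneg_left (hx.1 J) hs
    have h2 := mul_le_mul_of_nonneg_left (hy.1 J) ht
    have h3 : ∑ i ∈ J, a i = s * ∑ i ∈ J, a i + t * ∑ i ∈ J, a i := by
      rw [← add_mul, hst, one_mul]
    linarith
  · simp only [Pi.add_apply, Pi.smul_apply, smul_eq_mul, Finset.sum_add_distrib,
      ← Finset.mul_sum, ← hx.2, ← hy.2, ← add_mul, hst, one_mul]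

/-- The first k entries already carry the whole sum, so the remaining nonnegative entries vanish.
This reflects that k vectors span at most k dimensions. -/
theorem Majorized.zeroExtend_eq_zero {a : Fin k → ℝ} {x : Fin d → ℝ} (h : Majorized a x)
    (hx : 0 ≤ x) {l : ℕ} (hl : k ≤ l) : zeroExtend x l = 0 := by
  by_cases hld : d ≤ l
  · exact zeroExtend_of_le x hld
  have h0 : ∀ i, 0 ≤ zeroExtend x i := fun i => by
    unfold zeroExtend
    split_ifs
    exacts [hx _, le_rfl]
  have h1 := h.1 Finset.univ
  rw [h.2, Finset.card_univ, Fintype.card_fin, ← sum_range_zeroExtend] at h1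
  have h2 : ∑ i ∈ Finset.range k, zeroExtend x i + zeroExtend x l ≤
      ∑ i ∈ Finset.range d, zeroExtend x i := by
    rw [← Finset.sum_range_add_sum_Ico _ (show k ≤ d by omega)]
    exact add_le_add_right (Finset.single_le_sum (fun i _ => h0 i)
      (Finset.mem_Ico.2 ⟨hl, by omega⟩)) _
  exact le_antisymm (by linarith) (h0 l)

/-- The frame version of Horn's theorem. -/
theorem Majorized.exists_frame [FiniteDimensional ℂ H] {a : Fin k → ℝ} {x : Fin d → ℝ}
    (h : Majorized a x) (hx : 0 ≤ x) (b : OrthonormalBasis (Fin d) ℂ H) :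
    ∃ G : Fin k → H, IsDiag (frameOperator G) b x ∧ ∀ i, ‖G i‖ ^ 2 = a i := by
  let σ : Equiv.Perm (Fin k) := Tuple.sort (-a)
  have hσ : Antitone (a ∘ σ) := by
    have := (Tuple.monotone_sort (-a)).neg
    intro i j hij
    simpa using! this hij
  suffices hmain : ∃ G : Fin k → H, frameOperator G = diagOp b x ∧ ∀ i, ‖G i‖ ^ 2 = (a ∘ σ) i by
    obtain ⟨G, hG, hGa⟩ := hmain
    refine ⟨G ∘ σ.symm, ?_, fun i => by simp [hGa]⟩
    have : frameOperator (G ∘ σ.symm) = frameOperator G :=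
      Equiv.sum_comp σ.symm fun i => InnerProductSpace.rankOne ℂ (G i) (G i)
    rw [this, hG]
    exact isDiag_diagOp b x
  refine transfer_induction exists_frame_transfer hσ (fun i => zeroExtend x i) (fun m => ?_) ?_ ?_
  · have h1 := h.1 ((Finset.Iic m).map σ.toEmbedding)
    rw [Finset.sum_map, Finset.card_map, Fin.card_Iic] at h1
    refine h1.trans_eq ?_
    rw [show Finset.range (m + 1) = (Finset.Iic m).map Fin.valEmbedding by
      rw [Fin.map_valEmbedding_Iic]; ext; simp, Finset.sum_map]
    rfl
  · rw [Function.comp_def, Equiv.sum_comp σ a, h.2, Fin.sum_univ_eq_sum_range (zeroExtend x) k,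
      ← sum_range_zeroExtend]
    rcases le_total k d with hkd | hdk
    · rw [← Finset.sum_range_add_sum_Ico _ hkd, Finset.sum_eq_zero (s := Finset.Ico k d), add_zero]
      intro i hi
      exact h.zeroExtend_eq_zero hx (Finset.mem_Ico.1 hi).1
    · rw [← Finset.sum_range_add_sum_Ico _ hdk, Finset.sum_eq_zero (s := Finset.Ico d k), add_zero]
      intro i hi
      exact zeroExtend_of_le x (Finset.mem_Ico.1 hi).1
  -- The starting frame of the transfers consists of the vectors √x_i b_i, padded by zeros if k > d.
  -- If k < d, the omitted vectors have x_i = 0.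
  · let G : Fin k → H := fun i =>
      if hi : (i : ℕ) < d then ((√(x ⟨i, hi⟩) : ℝ) : ℂ) • b ⟨i, hi⟩ else 0
    refine ⟨G, ?_, fun i => ?_⟩
    · refine IsDiag.ext (b := b) (x := x) (fun l => ?_) (isDiag_diagOp b x)
      rw [frameOperator_apply]
      have hzero : ∀ i : Fin k, (i : ℕ) ≠ l → inner ℂ (G i) (b l) = 0 := fun i hi => by
        simp only [G]
        split_ifs with hd
        · rw [inner_smul_left, b.orthonormal.2 (by simpa [Fin.ext_iff] using hi), mul_zero]
        · exact inner_zero_left _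
      by_cases hl : (l : ℕ) < k
      · rw [Finset.sum_eq_single ⟨l, hl⟩
          (fun i _ hi => by rw [hzero i (by simpa [Fin.ext_iff] using hi), zero_smul]) (by simp)]
        have hG : G ⟨l, hl⟩ = ((√(x l) : ℝ) : ℂ) • b l := by simp [G]
        rw [hG, inner_smul_left, b.inner_eq_one, mul_one, Complex.conj_ofReal, smul_smul,
          ← Complex.ofReal_mul, Real.mul_self_sqrt (hx l)]
      · have h0 := h.zeroExtend_eq_zero hx (not_lt.1 hl)
        rw [zeroExtend_val] at h0
        rw [h0, Finset.sum_eq_zero fun i _ => by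
          rw [hzero i (by have := i.2; omega), zero_smul]]
        simp
    · simp only [G, zeroExtend]
      split_ifs with hd
      · rw [norm_smul, b.norm_eq_one, mul_one, Complex.norm_real, Real.norm_eq_abs, sq_abs,
          Real.sq_sqrt (hx _)]
      · simp

theorem re_inner_sum_rankOne (J : Finset (Fin k)) (G : Fin k → H) (v : H) :
    (inner ℂ v ((∑ i ∈ J, InnerProductSpace.rankOne ℂ (G i) (G i)) v)).re =
      ∑ i ∈ J, ‖inner ℂ (G i) v‖ ^ 2 := by
  rw [sum_apply, inner_sum, Complex.re_sum]
  refine Finset.sum_congr rfl fun i _ => ?_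
  rw [InnerProductSpace.rankOne_apply, inner_smul_right, ← inner_conj_symm v (G i),
    Complex.mul_conj, Complex.ofReal_re, Complex.normSq_eq_norm_sq]

/-- The frame version of Schur's theorem. -/
theorem IsDiag.majorized [FiniteDimensional ℂ H] {G : Fin k → H} {x : Fin d → ℝ}
    {b : OrthonormalBasis (Fin d) ℂ H} (h : IsDiag (frameOperator G) b x) (hx : Antitone x) :
    Majorized (fun i => ‖G i‖ ^ 2) x := by
  have hn : Module.finrank ℂ H = d := by simpa using Module.finrank_eq_card_basis b.toBasis
  refine ⟨fun J => ?_, by rw [← reTrace_frameOperator, h.reTrace_eq]⟩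
  -- The partial frame operator satisfies 0 ≤ T ≤ S_G and has rank at most |J|. Its trace is
  -- therefore the sum of its first |J| eigenvalues, each bounded by that of S_G.
  set T := ∑ i ∈ J, InnerProductSpace.rankOne ℂ (G i) (G i) with hT
  have hsymm : (T : H →ₗ[ℂ] H).IsSymmetric := by
    intro u v
    simp only [hT, ContinuousLinearMap.coe_coe, sum_apply, InnerProductSpace.rankOne_apply,
      sum_inner, inner_sum, inner_smul_left, inner_smul_right, inner_conj_symm]
    exact Finset.sum_congr rfl fun i _ => mul_comm _ _
  obtain ⟨b', e, he, hanti⟩ := exists_isDiag hn hsymm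
  have hex : e ≤ x := by
    refine he.le_of_le h hanti hx fun v => ?_
    rw [frameOperator, re_inner_sum_rankOne, re_inner_sum_rankOne]
    exact Finset.sum_le_sum_of_subset_of_nonneg (Finset.subset_univ J) fun _ _ _ => by positivity
  have he0 : ∀ i, 0 ≤ e i := fun i => by
    have : e i = (inner ℂ (b' i) (T (b' i))).re := by
      rw [he i, inner_smul_right, b'.inner_eq_one, mul_one, Complex.ofReal_re]
    rw [this, re_inner_sum_rankOne]
    exact Finset.sum_nonneg fun _ _ => by positivity
  have hzero : ∀ i : Fin d, J.card ≤ i → e i = 0 := by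
    classical
    intro i hi
    by_contra hne
    have hpos : 0 < e i := lt_of_le_of_ne (he0 i) (Ne.symm hne)
    -- If e_i > 0, the i + 1 leading eigenvectors lie in the range of T, inside the span of the G_l
    -- with l in J, which has dimension at most |J| ≤ i.
    have hsub : Submodule.span ℂ (Set.range fun j : {j : Fin d // j ≤ i} => b' j) ≤
        Submodule.span ℂ ((J.image G : Finset H) : Set H) := by
      refine Submodule.span_le.2 ?_
      rintro _ ⟨j, rfl⟩
      have hj : (e j : ℂ) ≠ 0 := by exact_mod_cast (hpos.trans_le (hanti j.2)).ne'
      have : b' j = (e j : ℂ)⁻¹ • T (b' j) := by rw [he j, smul_smul, inv_mul_cancel₀ hj, one_smul]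
      change b' j ∈ _
      rw [this, hT, sum_apply]
      refine Submodule.smul_mem _ _ (Submodule.sum_mem _ fun l hl => ?_)
      rw [InnerProductSpace.rankOne_apply]
      exact Submodule.smul_mem _ _ (Submodule.subset_span (by simpa using ⟨l, hl, rfl⟩))
    have h1 := (Submodule.finrank_mono hsub).trans (finrank_span_finset_le_card _)
    have h2 : Module.finrank ℂ (Submodule.span ℂ
        (Set.range fun j : {j : Fin d // j ≤ i} => b' j)) = i + 1 := by
      rw [← Fin.card_Iic i, ← Fintype.card_of_subtype _ fun j => Finset.mem_Iic]
      exact finrank_span_eq_card (b'.orthonormal.linearIndependent.comp _ Subtype.val_injective)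
    have h3 := Finset.card_image_le (s := J) (f := G)
    omega
  have hzero' : ∀ i, J.card ≤ i → zeroExtend e i = 0 := fun i hi => by
    unfold zeroExtend
    split_ifs
    exacts [hzero _ hi, rfl]
  have htr : ∑ i ∈ J, ‖G i‖ ^ 2 = ∑ i ∈ Finset.range J.card, zeroExtend e i := by
    have h1 : ∑ i ∈ J, ‖G i‖ ^ 2 = reTrace T := by simp only [hT, map_sum, reTrace_rankOne_self]
    rw [h1, he.reTrace_eq, ← sum_range_zeroExtend]
    rcases le_total J.card d with hkd | hdk
    · rw [← Finset.sum_range_add_sum_Ico _ hkd, Finset.sum_eq_zero (s := Finset.Ico J.card d),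
        add_zero]
      intro i hi
      exact hzero' i (Finset.mem_Ico.1 hi).1
    · rw [← Finset.sum_range_add_sum_Ico _ hdk, Finset.sum_eq_zero (s := Finset.Ico d J.card),
        add_zero]
      intro i hi
      exact zeroExtend_of_le e (Finset.mem_Ico.1 hi).1
  rw [htr]
  exact Finset.sum_le_sum fun i _ => zeroExtend_mono hex i

end SchurHorn

/-! ### Monotone rearrangements. -/

section Rearrangement

theorem incRearr_monotone {m : ℕ} (x : Fin m → ℝ) : Monotone (incRearr x) :=
  Tuple.monotone_sort x

theorem decRearr_eq_comp {m : ℕ} (x : Fin m → ℝ) :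
    decRearr x = x ∘ (Fin.revPerm.trans (Tuple.sort x)) := rfl

theorem decRearr_antitone {m : ℕ} (x : Fin m → ℝ) : Antitone (decRearr x) :=
  fun _ _ h => incRearr_monotone x (Fin.rev_le_rev.2 h)

theorem incRearr_of_antitone {m : ℕ} {x : Fin m → ℝ} (hx : Antitone x) :
    incRearr x = x ∘ Fin.revPerm :=
  ((Tuple.comp_sort_eq_comp_iff_monotone (f := x) (σ := Fin.revPerm)).2
    fun _ _ h => hx (Fin.rev_le_rev.2 h)).symm

end Rearrangement

/-! ### Spectrum and potential of a frame operator. -/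

section Spectrum

variable {H : Type*} [NormedAddCommGroup H] [InnerProductSpace ℂ H] {n d : ℕ}

theorem IsDiag.frameOperator_nonneg {F : Fin n → H} {b : OrthonormalBasis (Fin d) ℂ H}
    {x : Fin d → ℝ} (h : IsDiag (frameOperator F) b x) : 0 ≤ x := fun i => by
  have : x i = (inner ℂ (b i) (frameOperator F (b i))).re := by
    rw [h i, inner_smul_right, b.inner_eq_one, mul_one, Complex.ofReal_re]
  rw [Pi.zero_apply, this, frameOperator, re_inner_sum_rankOne]
  exact Finset.sum_nonneg fun _ _ => by positivity

theorem IsDiag.convexPotential_eq [FiniteDimensional ℂ H] [CompleteSpace H] {F : Fin n → H}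
    {b : OrthonormalBasis (Fin d) ℂ H} {x : Fin d → ℝ} (h : IsDiag (frameOperator F) b x)
    (f : ℝ → ℝ) : convexPotential f F = ∑ i, f (x i) :=
  (h.cfc_isDiag f).reTrace_eq

variable [FiniteDimensional ℂ H]

theorem exists_isDiag_frameSpectrum (F : Fin n → H) :
    ∃ b : OrthonormalBasis (Fin (Module.finrank ℂ H)) ℂ H,
      IsDiag (frameOperator F) b (frameSpectrum F) :=
  ⟨(frameOperator_isSymmetric F).eigenvectorBasis rfl,
    fun i => (frameOperator_isSymmetric F).apply_eigenvectorBasis rfl i⟩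

theorem IsDiag.frameSpectrum_eq {F : Fin n → H}
    {b : OrthonormalBasis (Fin (Module.finrank ℂ H)) ℂ H} {x : Fin (Module.finrank ℂ H) → ℝ}
    (h : IsDiag (frameOperator F) b x) (hx : Antitone x) : frameSpectrum F = x := by
  obtain ⟨b', hb'⟩ := exists_isDiag_frameSpectrum F
  exact hb'.eq_of_antitone h (frameSpectrum_antitone F) hx

theorem frameSpectrum_nonneg (F : Fin n → H) : 0 ≤ frameSpectrum F := by
  obtain ⟨b, hb⟩ := exists_isDiag_frameSpectrum F
  exact hb.frameOperator_nonneg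

theorem exists_isDiag_incRearr_frameSpectrum (F : Fin n → H) :
    ∃ b : OrthonormalBasis (Fin (Module.finrank ℂ H)) ℂ H,
      IsDiag (frameOperator F) b (incRearr (frameSpectrum F)) := by
  obtain ⟨b, hb⟩ := exists_isDiag_frameSpectrum F
  exact ⟨_, hb.reindex (Tuple.sort (frameSpectrum F))⟩

theorem majorized_frameSpectrum (F : Fin n → H) :
    Majorized (fun i => ‖F i‖ ^ 2) (frameSpectrum F) := by
  obtain ⟨b, hb⟩ := exists_isDiag_frameSpectrum F
  exact hb.majorized (frameSpectrum_antitone F)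

end Spectrum

/-! ### Completions, the lower bound for the potential, and the local-to-global argument. -/

section Completions

theorem completing_append {H : Type*} {n₀ k : ℕ} (F₀ : Fin n₀ → H) (G : Fin k → H) :
    completing (Fin.append F₀ G) = G :=
  funext fun i => Fin.append_right _ _ i

theorem append_mem_completions {H : Type*} [NormedAddCommGroup H] {n₀ k : ℕ} {F₀ : Fin n₀ → H}
    {a : Fin k → ℝ} {G : Fin k → H} (hG : ∀ i, ‖G i‖ ^ 2 = a i) :
    Fin.append F₀ G ∈ completions F₀ a :=
  ⟨fun i => Fin.append_left _ _ i, fun i => by rw [completing, Fin.append_right, hG]⟩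

variable {H : Type*} [NormedAddCommGroup H] [InnerProductSpace ℂ H] {n₀ k : ℕ}
  {F₀ : Fin n₀ → H} {a : Fin k → ℝ} {F : Fin (n₀ + k) → H}

theorem frameOperator_eq_add (hF : F ∈ completions F₀ a) :
    frameOperator F = frameOperator F₀ + frameOperator (completing F) := by
  simp only [frameOperator, Fin.sum_univ_add, hF.1, completing]

variable [FiniteDimensional ℂ H]

/-- A converse to `exists_common_basis_of_mem_opCompletions`: in a common eigenbasis with opposite
orders, the spectrum of the sum can be read off. -/
theorem mem_opCompletions_of_isDiag (hF : F ∈ completions F₀ a) {y : Fin (Module.finrank ℂ H) → ℝ}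
    {b : OrthonormalBasis (Fin (Module.finrank ℂ H)) ℂ H}
    (h₀ : IsDiag (frameOperator F₀) b (frameSpectrum F₀))
    (hG : IsDiag (frameOperator (completing F)) b (y ∘ Fin.revPerm)) (hy : Antitone y) :
    F ∈ opCompletions F₀ a := by
  refine ⟨hF, ?_⟩
  have hGy : frameSpectrum (completing F) = y := by
    refine IsDiag.frameSpectrum_eq (b := b.reindex Fin.revPerm.symm) ?_ hy
    simpa [Function.comp_def] using hG.reindex Fin.revPerm
  have hS := h₀.add hG
  rw [← frameOperator_eq_add hF] at hS
  rw [hGy, incRearr_of_antitone hy]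
  rw [decRearr_eq_comp]
  exact (hS.reindex _).frameSpectrum_eq (decRearr_antitone (frameSpectrum F₀ + y ∘ Fin.revPerm))

variable [CompleteSpace H]

theorem convexPotential_of_mem_opCompletions (hF : F ∈ opCompletions F₀ a) (f : ℝ → ℝ) :
    convexPotential f F =
      ∑ i, f (frameSpectrum F₀ i + incRearr (frameSpectrum (completing F)) i) := by
  obtain ⟨b, hb⟩ := exists_isDiag_frameSpectrum F
  rw [hb.convexPotential_eq, hF.2, decRearr_eq_comp]
  exact Equiv.sum_comp _ fun i => f ((frameSpectrum F₀ + incRearr (frameSpectrum (completing F))) i)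

theorem le_convexPotential_of_mem_completions (hF : F ∈ completions F₀ a) {f : ℝ → ℝ}
    (hf : ConvexOn ℝ (Set.Ici 0) f) :
    ∑ i, f (frameSpectrum F₀ i + incRearr (frameSpectrum (completing F)) i) ≤
      convexPotential f F := by
  obtain ⟨b, hb⟩ := exists_isDiag_frameSpectrum F
  obtain ⟨u, hu⟩ := exists_isDiag_frameSpectrum F₀
  obtain ⟨v, hv⟩ := exists_isDiag_incRearr_frameSpectrum (completing F)
  rw [hb.convexPotential_eq]
  rw [frameOperator_eq_add hF] at hb
  exact sum_le_sum_of_isDiag_add hu hv hb (frameSpectrum_antitone F₀) (incRearr_monotone _) hf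
    (fun i => add_nonneg (frameSpectrum_nonneg F₀ i) (hv.frameOperator_nonneg i))
    (frameSpectrum_nonneg F)

theorem exists_common_basis_of_mem_opCompletions (hF : F ∈ opCompletions F₀ a) :
    ∃ b : OrthonormalBasis (Fin (Module.finrank ℂ H)) ℂ H,
      IsDiag (frameOperator F₀) b (frameSpectrum F₀) ∧
        IsDiag (frameOperator (completing F)) b (incRearr (frameSpectrum (completing F))) := by
  obtain ⟨w, hw⟩ := exists_isDiag_frameSpectrum F
  obtain ⟨u, hu⟩ := exists_isDiag_frameSpectrum F₀
  obtain ⟨v, hv⟩ := exists_isDiag_incRearr_frameSpectrum (completing F)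
  rw [frameOperator_eq_add hF.1] at hw
  refine hu.exists_common_of_sum_sq_eq hv hw (frameSpectrum_antitone F₀) (incRearr_monotone _) ?_
  rw [hF.2, decRearr_eq_comp]
  exact Equiv.sum_comp _ fun i =>
    (frameSpectrum F₀ + incRearr (frameSpectrum (completing F))) i ^ 2

/-- A local minimizer of a convex potential among the optimal completions is a global minimizer
among all completions. -/
theorem IsDSLocalMinimizer.le_of_mem_completions {f : ℝ → ℝ} (hf : ConvexOn ℝ (Set.Ici 0) f)
    (hF : IsDSLocalMinimizer (convexPotential f) (opCompletions F₀ a) F)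
    {F' : Fin (n₀ + k) → H} (hF' : F' ∈ completions F₀ a) :
    convexPotential f F ≤ convexPotential f F' := by
  obtain ⟨hFop, ε, hε, hmin⟩ := hF
  by_contra! hlt
  obtain ⟨b, hb₀, hbG⟩ := exists_common_basis_of_mem_opCompletions hFop
  have hle := le_convexPotential_of_mem_completions hF' hf
  have hPF := convexPotential_of_mem_opCompletions hFop f
  set l := frameSpectrum F₀
  set y := frameSpectrum (completing F) with hy
  set y' := frameSpectrum (completing F') with hy'
  have hyanti : Antitone y := frameSpectrum_antitone _
  have hyanti' : Antitone y' := frameSpectrum_antitone _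
  have hynn : 0 ≤ y := frameSpectrum_nonneg _
  have hynn' : 0 ≤ y' := frameSpectrum_nonneg _
  rw [incRearr_of_antitone hyanti] at hbG hPF
  rw [incRearr_of_antitone hyanti'] at hle
  have hmaj : Majorized a y := by
    have := majorized_frameSpectrum (completing F)
    rwa [show (fun i => ‖completing F i‖ ^ 2) = a from funext hFop.1.2] at this
  have hmaj' : Majorized a y' := by
    have := majorized_frameSpectrum (completing F')
    rwa [show (fun i => ‖completing F' i‖ ^ 2) = a from funext hF'.2] at this
  -- D is the difference of the two spectra placed in the common basis. Moving by t along the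
  -- segment changes the frame operator by exactly tD, and t = ε / (‖D‖ + ε) keeps this below ε.
  let D := diagOp b (y ∘ Fin.revPerm - y' ∘ Fin.revPerm)
  obtain ⟨t, ht0, ht1, htD⟩ : ∃ t : ℝ, 0 < t ∧ t ≤ 1 ∧ t * ‖D‖ < ε := by
    have hpos : 0 < ‖D‖ + ε := by positivity
    refine ⟨ε / (‖D‖ + ε), by positivity, (div_le_one hpos).2 (by linarith [norm_nonneg D]), ?_⟩
    rw [div_mul_eq_mul_div, div_lt_iff₀ hpos]
    nlinarith
  have ht1' : 0 ≤ 1 - t := sub_nonneg.2 ht1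
  let z := (1 - t) • y + t • y'
  have hzanti : Antitone z := fun i j hij =>
    add_le_add (mul_le_mul_of_nonneg_left (hyanti hij) ht1')
      (mul_le_mul_of_nonneg_left (hyanti' hij) ht0.le)
  have hznn : 0 ≤ z := fun i =>
    add_nonneg (mul_nonneg ht1' (hynn i)) (mul_nonneg ht0.le (hynn' i))
  -- Horn's theorem is applied in the reversed basis, so that in b the spectrum z is increasing,
  -- opposite to that of S_{F₀}.
  obtain ⟨G, hG, hGa⟩ := (hmaj.combo hmaj' ht1' ht0.le (by ring)).exists_frame hznn
    (b.reindex Fin.revPerm)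
  have hGb : IsDiag (frameOperator G) b (z ∘ Fin.revPerm) := by
    intro i
    simpa [z] using hG (Fin.rev i)
  have hmem : Fin.append F₀ G ∈ completions F₀ a := append_mem_completions hGa
  have hGb' : IsDiag (frameOperator (completing (Fin.append F₀ G))) b (z ∘ Fin.revPerm) := by
    rwa [completing_append]
  have hop := mem_opCompletions_of_isDiag hmem hb₀ hGb' hzanti
  have hdist : dS F (Fin.append F₀ G) < ε := by
    have hsub : frameOperator (completing F) - frameOperator G = (t : ℂ) • D := by
      refine (hbG.sub hGb).ext (b := b) ?_
      convert! (isDiag_diagOp b (y ∘ Fin.revPerm - y' ∘ Fin.revPerm)).smul t using 1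
      ext i
      simp [z]
      ring
    rw [dS, frameOperator_eq_add hFop.1, frameOperator_eq_add hmem, completing_append,
      add_sub_add_left_eq_sub, hsub, norm_smul, Complex.norm_real, Real.norm_of_nonneg ht0.le]
    exact htD
  have hlocal := hmin _ hop hdist
  have hS := hb₀.add hGb'
  rw [← frameOperator_eq_add hmem] at hS
  have hconv : convexPotential f (Fin.append F₀ G) ≤
      (1 - t) * ∑ i, f (l i + (y ∘ Fin.revPerm) i) +
        t * ∑ i, f (l i + (y' ∘ Fin.revPerm) i) := by
    rw [hS.convexPotential_eq, Finset.mul_sum, Finset.mul_sum, ← Finset.sum_add_distrib]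
    refine Finset.sum_le_sum fun i _ => ?_
    have h1 : l i + (y ∘ Fin.revPerm) i ∈ Set.Ici (0 : ℝ) :=
      add_nonneg (frameSpectrum_nonneg F₀ i) (hynn _)
    have h2 : l i + (y' ∘ Fin.revPerm) i ∈ Set.Ici (0 : ℝ) :=
      add_nonneg (frameSpectrum_nonneg F₀ i) (hynn' _)
    have := hf.2 h1 h2 ht1' ht0.le (by ring)
    refine le_trans (le_of_eq (congrArg f ?_)) this
    simp only [Pi.add_apply, Function.comp_apply, Pi.smul_apply, smul_eq_mul, z]
    ring
  rw [← hPF] at hconv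
  -- If P_f(F') < P_f(F), the second sum is below P_f(F). As t > 0, the new completion then has
  -- potential strictly below P_f(F), against local minimality.
  nlinarith

end Completions

end FrameCompletion

theorem mainTheorem8 {H : Type*} [NormedAddCommGroup H] [InnerProductSpace ℂ H]
    [CompleteSpace H] [FiniteDimensional ℂ H] {n₀ k : ℕ}
    (F₀ : Fin n₀ → H) (a : Fin k → ℝ) (ha : ∀ i, 0 < a i)
    (hk : Module.finrank ℂ H ≤
      Module.finrank ℂ (LinearMap.range (FrameCompletion.frameOperator F₀ : H →ₗ[ℂ] H)) + k)
    (f : ℝ → ℝ) (hf : StrictConvexOn ℝ (Set.Ici 0) f)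
    (F : Fin (n₀ + k) → H)
    (hF : FrameCompletion.IsDSLocalMinimizer (FrameCompletion.convexPotential f)
      (FrameCompletion.opCompletions F₀ a) F) :
    IsMinOn (FrameCompletion.convexPotential f) (FrameCompletion.opCompletions F₀ a) F ∧
      IsMinOn (FrameCompletion.convexPotential f) (FrameCompletion.completions F₀ a) F :=
  ⟨fun _ hF' => hF.le_of_mem_completions hf.convexOn hF'.1,
    fun _ hF' => hF.le_of_mem_completions hf.convexOn hF'⟩
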